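/- Let $m>0$. Write $\mathcal S(\mathbb R^4)$ for the space of real-valued Schwartz functions on $\mathbb R^4$ with its usual Fréchet topology, and $\mathcal S'(\mathbb R^4)$ for its continuous dual, with the weak-$*$ topology and its Borel $\sigma$-algebra; $\varphi(f)$ denotes the pairing of $\varphi\in\mathcal S'(\mathbb R^4)$ with $f\in\mathcal S(\mathbb R^4)$. Let $$K(x,y)=\frac{m}{4\pi^2|x-y|}\,K_1(m|x-y|)\quad(x\ne y),\qquad K_1(z)=\int_0^\infty e^{-z\cosh t}\cosh t\,dt\quad(z>0),$$ be the free propagator of mass $m$ ($K_1$ is the modified Bessel function of the second kind). Then for all $f,g\in\mathcal S(\mathbb R^4)$ the integral $$C(f,g)=\int_{\mathbb R^4\times\mathbb R^4}K(x,y)\,f(x)\,g(y)\,dx\,dy$$ converges absolutely, and $C$ is a (jointly) continuous, symmetric, positive semidefinite bilinear form on $\mathcal S(\mathbb R^4)$, the free covariance form. Moreover there exists a unique Borel probability measure $\mu$ on $\mathcal S'(\mathbb R^4)$, the Gaussian free field of mass $m$, such that $$\int_{\mathcal S'(\mathbb R^4)}e^{i\varphi(f)}\,d\mu(\varphi)=\exp\!\left(-\tfrac12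 C(f,f)\right)\qquad\text{for all } f\in\mathcal S(\mathbb R^4).$$ -/

import Mathlib

namespace GFF

noncomputable section

open MeasureTheory

/-- Euclidean spacetime `ℝ⁴`. -/
abbrev Spacetime : Type := EuclideanSpace ℝ (Fin 4)

/-- The real Schwartz space `S(ℝ⁴)`, with its Fréchet topology. -/
abbrev TestFunction : Type := SchwartzMap Spacetime ℝ

/-- The space `S'(ℝ⁴)` of real tempered distributions: the continuous dual of `S(ℝ⁴)`, with the
weak-* topology. -/
abbrev TemperedDual : Type := WeakDual ℝ TestFunction

/-- `S'(ℝ⁴)` carries its Borel σ-algebra. -/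
instance : MeasurableSpace TemperedDual := borel TemperedDual

instance : BorelSpace TemperedDual := ⟨rfl⟩

/-- The modified Bessel function of the second kind `K_ν(z)`, for `z > 0`, by the absolutely
convergent integral `∫₀^∞ exp (-z cosh t) cosh (ν t) dt`. -/
def besselK (ν z : ℝ) : ℝ :=
  ∫ t in Set.Ioi (0 : ℝ), Real.exp (-z * Real.cosh t) * Real.cosh (ν * t)

/-- The free propagator `K(x, y) = m / (4 π² |x - y|) · K₁(m |x - y|)` of mass `m` on `ℝ⁴`
(the value on the null set `x = y` is irrelevant). -/
def freePropagator (m : ℝ) (x y : Spacetime) : ℝ :=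
  m / (4 * Real.pi ^ 2 * ‖x - y‖) * besselK 1 (m * ‖x - y‖)

/-- The integrand `(x, y) ↦ K(x, y) f(x) g(y)` of the free covariance form. -/
def covarianceIntegrand (m : ℝ) (f g : TestFunction) (p : Spacetime × Spacetime) : ℝ :=
  freePropagator m p.1 p.2 * f p.1 * g p.2

/-- The free covariance form `C(f, g) = ∫∫ K(x, y) f(x) g(y) dx dy`. -/
def freeCovariance (m : ℝ) (f g : TestFunction) : ℝ :=
  ∫ p : Spacetime × Spacetime, covarianceIntegrand m f g p

/-- The characteristic functional `f ↦ ∫ exp(i φ(f)) dμ(φ)` of a measure on `S'(ℝ⁴)`. -/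
def charFunctional (μ : Measure TemperedDual) (f : TestFunction) : ℂ :=
  ∫ φ : TemperedDual, Complex.exp (Complex.I * ((φ f : ℝ) : ℂ)) ∂μ

end

end GFF

/-! ### Gaussian vectors in a Hilbert space -/

namespace GFF

open MeasureTheory ProbabilityTheory Complex Filter Topology
open scoped InnerProductSpace ENNReal

/-! The propagator is the time integral of the massive heat kernel, so it is integrable and its
Fourier transform is `ρ(w) = (m² + 4π²|w|²)⁻¹`. Hence `C(f, g) = ⟪T f, T g⟫` with `T f = √ρ f̂`
continuous from test functions to `L²(ℝ⁴; ℂ)` (`freeCovariance_eq_inner`). Continuity, symmetry and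
positivity follow at once; absolute convergence comes from integrability of the propagator.

Existence is by explicit construction. `T` factors as `T = A B`, where `B f = (1 + |x|²)² (1 -
Δ/4π²)² f` maps test functions continuously into real `L²`, and `A` is integration against a
square-integrable `L²`-valued kernel of damped plane waves (`integral_sobolevMap_smul`). So `A` is
Hilbert–Schmidt, and `C(f, f) = ∑ ⟪B f, vᵢ⟫²` with `∑ ‖vᵢ‖² < ∞`
(`exists_hilbertSchmidt_coefficients`). For independent standard Gaussians `ξᵢ`, the series `Z = ∑
ξᵢ vᵢ` converges in mean square (`exists_gaussian_measure`), and the field is the law of `f ↦ ⟪Z, B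
f⟫`.

For uniqueness, linearity lets the characteristic functional determine all finite-dimensional laws,
hence the measure on cylinder sets. These are all the Borel sets: Schwartz space is separable, and
its dual is a countable union of equicontinuous sets, on each of which the weak-* topology is seen
by countably many evaluations (`borel_temperedDual_le_cylinder`). -/

/-- Dependence of `𝔼 exp(iY)` on `Y ∈ L²`. -/
lemma norm_integral_cexp_sub_le {Ω : Type*} [MeasurableSpace Ω] (P : Measure Ω)
    [IsProbabilityMeasure P] (X Y : Lp ℝ 2 P) :
    ‖∫ ω, cexp (I * (X ω : ℝ)) ∂P - ∫ ω, cexp (I * (Y ω : ℝ)) ∂P‖ ≤ ‖X - Y‖ := by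
  have hint : ∀ Z : Lp ℝ 2 P, Integrable (fun ω => cexp (I * (Z ω : ℝ))) P := fun Z => by
    refine Integrable.of_bound (C := 1) ?_ (ae_of_all _ fun ω => ?_)
    · have := (Lp.stronglyMeasurable Z).aestronglyMeasurable (μ := P)
      exact Complex.continuous_exp.comp_aestronglyMeasurable
        ((Complex.continuous_ofReal.comp_aestronglyMeasurable this).const_mul I)
    · rw [mul_comm, Complex.norm_exp_ofReal_mul_I]
  rw [← integral_sub (hint X) (hint Y)]
  have hXY : MemLp (X - Y : Lp ℝ 2 P) 1 P := (Lp.memLp (X - Y)).mono_exponent (by norm_num)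
  calc ‖∫ ω, (cexp (I * (X ω : ℝ)) - cexp (I * (Y ω : ℝ))) ∂P‖
      ≤ ∫ ω, ‖(X - Y : Lp ℝ 2 P) ω‖ ∂P := by
        refine norm_integral_le_of_norm_le (hXY.integrable le_rfl).norm ?_
        filter_upwards [Lp.coeFn_sub X Y] with ω hω
        rw [hω, Pi.sub_apply]
        have h : cexp (I * (X ω : ℝ)) - cexp (I * (Y ω : ℝ))
            = cexp (I * (Y ω : ℝ)) * (cexp (I * ((X ω - Y ω : ℝ) : ℂ)) - 1) := by
          rw [mul_sub, ← Complex.exp_add]; push_cast; ring_nf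
        rw [h, norm_mul, mul_comm I, Complex.norm_exp_ofReal_mul_I, one_mul]
        exact Real.norm_exp_I_mul_ofReal_sub_one_le
    _ = (eLpNorm (X - Y : Lp ℝ 2 P) 1 P).toReal := by
        rw [integral_norm_eq_lintegral_enorm hXY.1, eLpNorm_one_eq_lintegral_enorm]
    _ ≤ ‖X - Y‖ := by
        rw [Lp.norm_def]
        exact ENNReal.toReal_mono (Lp.eLpNorm_ne_top _)
          (eLpNorm_le_eLpNorm_of_exponent_le (by norm_num) hXY.1)

/-- The law of a family of independent standard Gaussian variables. -/
noncomputable abbrev stdGaussianFamily (ι : Type*) : Measure (ι → ℝ) :=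
  Measure.infinitePi (fun _ : ι => gaussianReal 0 1)

section
variable {ι : Type*}

lemma map_eval_stdGaussianFamily (i : ι) :
    (stdGaussianFamily ι).map (fun ω => ω i) = gaussianReal 0 1 :=
  Measure.infinitePi_map_eval _ i

@[fun_prop]
lemma aemeasurable_eval_stdGaussianFamily (i : ι) :
    AEMeasurable (fun ω : ι → ℝ => ω i) (stdGaussianFamily ι) :=
  (measurable_pi_apply i).aemeasurable

@[fun_prop]
lemma aestronglyMeasurable_eval_stdGaussianFamily (i : ι) :
    AEStronglyMeasurable (fun ω : ι → ℝ => ω i) (stdGaussianFamily ι) :=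
  (measurable_pi_apply i).aestronglyMeasurable

lemma iIndepFun_stdGaussianFamily : iIndepFun (fun i (ω : ι → ℝ) => ω i) (stdGaussianFamily ι) :=
  iIndepFun_infinitePi (X := fun _ x => x) (fun _ => measurable_id)

lemma memLp_eval_stdGaussianFamily (i : ι) : MemLp (fun ω : ι → ℝ => ω i) 2 (stdGaussianFamily ι) := by
  have h : MemLp id 2 ((stdGaussianFamily ι).map (fun ω => ω i)) := by
    rw [map_eval_stdGaussianFamily]; exact memLp_id_gaussianReal 2
  exact (memLp_map_measure_iff aestronglyMeasurable_id (by fun_prop)).1 h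

lemma integral_eval_stdGaussianFamily (i : ι) : ∫ ω, ω i ∂(stdGaussianFamily ι) = 0 := by
  have := integral_map (μ := stdGaussianFamily ι) (φ := fun ω : ι → ℝ => ω i)
    (by fun_prop) (f := id) aestronglyMeasurable_id
  rw [map_eval_stdGaussianFamily] at this
  simpa [integral_id_gaussianReal] using this.symm

lemma integral_sq_eval_stdGaussianFamily (i : ι) : ∫ ω, ω i * ω i ∂(stdGaussianFamily ι) = 1 := by
  have := integral_map (μ := stdGaussianFamily ι) (φ := fun ω : ι → ℝ => ω i)
    (by fun_prop) (f := fun x => x * x) (by fun_prop)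
  rw [map_eval_stdGaussianFamily] at this
  rw [← this]
  have h := variance_id_gaussianReal (μ := 0) (v := 1)
  rw [variance_of_integral_eq_zero (by fun_prop) (by simp [integral_id_gaussianReal])] at h
  simpa [pow_two] using h

lemma integral_mul_eval_stdGaussianFamily {i j : ι} (hij : i ≠ j) :
    ∫ ω, ω i * ω j ∂(stdGaussianFamily ι) = 0 := by
  have h := (iIndepFun_stdGaussianFamily (ι := ι)).indepFun hij
  rw [h.integral_fun_mul_eq_mul_integral (by fun_prop) (by fun_prop), integral_eval_stdGaussianFamily,
    zero_mul]

lemma integral_cexp_sum_stdGaussianFamily (s : Finset ι) (c : ι → ℝ) :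
    ∫ ω, cexp (I * ((∑ i ∈ s, ω i * c i : ℝ) : ℂ)) ∂(stdGaussianFamily ι)
      = Real.exp (-(1 / 2) * ∑ i ∈ s, c i ^ 2) := by
  have hX : iIndepFun (fun i (ω : ι → ℝ) => ω i * c i) (stdGaussianFamily ι) :=
    (iIndepFun_stdGaussianFamily (ι := ι)).comp (fun i x => x * c i) (fun i => by fun_prop)
  -- The left side is the characteristic function of the sum at the point 1, which factors by
  -- independence.
  have h := congrFun (iIndepFun.charFun_map_fun_finsetSum_eq_prod (s := s)
    (X := fun i (ω : ι → ℝ) => ω i * c i) (fun i _ => by fun_prop) (hX.restrict s)) 1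
  rw [charFun_apply_real, integral_map (by fun_prop) (by fun_prop)] at h
  have e : ∀ i, charFun ((stdGaussianFamily ι).map (fun ω : ι → ℝ => ω i * c i)) 1
      = cexp (-(1/2) * (c i : ℂ) ^ 2) := fun i => by
    rw [charFun_apply_real, integral_map (by fun_prop) (by fun_prop)]
    have h1 : charFun ((stdGaussianFamily ι).map (fun ω : ι → ℝ => ω i)) (c i)
      = cexp (-(1/2) * (c i : ℂ) ^ 2) := by
      rw [map_eval_stdGaussianFamily, charFun_gaussianReal]; congr 1; push_cast; ring
    rw [← h1, charFun_apply_real, integral_map (by fun_prop) (by fun_prop)]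
    congr 1; ext ω; push_cast; ring_nf
  rw [Finset.prod_apply, Finset.prod_congr rfl (fun i _ => e i), ← Complex.exp_sum] at h
  convert h using 1
  · congr 1; ext ω; push_cast; ring_nf
  · push_cast; rw [Finset.mul_sum]

variable {E : Type*} [NormedAddCommGroup E] [InnerProductSpace ℝ E]

lemma memLp_eval_smul (i : ι) (x : E) :
    MemLp (fun ω : ι → ℝ => ω i • x) 2 (stdGaussianFamily ι) :=
  ((ContinuousLinearMap.id ℝ ℝ).smulRight x).comp_memLp' (memLp_eval_stdGaussianFamily i)

/-- The case `i = j` makes `x ↦ ξᵢ x` isometric; the case `i ≠ j` makes the images orthogonal. -/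
lemma inner_toLp_eval_smul (i j : ι) (x y : E) :
    ⟪(memLp_eval_smul i x).toLp, (memLp_eval_smul j y).toLp⟫_ℝ
      = (∫ ω, ω i * ω j ∂(stdGaussianFamily ι)) * ⟪x, y⟫_ℝ := by
  rw [L2.inner_def, ← integral_mul_const]
  refine integral_congr_ae ?_
  filter_upwards [(memLp_eval_smul i x).coeFn_toLp, (memLp_eval_smul j y).coeFn_toLp] with ω h1 h2
  rw [h1, h2, real_inner_smul_left, real_inner_smul_right, mul_assoc]

/-- The isometric embedding `x ↦ ξᵢ x` of `E` into `L²(Ω; E)`. -/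
noncomputable def gaussianIsometry (E : Type*) [NormedAddCommGroup E] [InnerProductSpace ℝ E]
    (i : ι) : E →ₗᵢ[ℝ] Lp E 2 (stdGaussianFamily ι) where
  toFun x := (memLp_eval_smul i x).toLp
  map_add' x y := by
    rw [← MemLp.toLp_add]; exact MemLp.toLp_congr _ _ (ae_of_all _ fun ω => smul_add _ _ _)
  map_smul' c x := by
    rw [RingHom.id_apply, ← MemLp.toLp_const_smul]
    exact MemLp.toLp_congr _ _ (ae_of_all _ fun ω => smul_comm _ _ _)
  norm_map' x := by
    have h := inner_toLp_eval_smul i i x x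
    rw [integral_sq_eval_stdGaussianFamily, one_mul, real_inner_self_eq_norm_sq,
      real_inner_self_eq_norm_sq] at h
    exact (pow_left_inj₀ (norm_nonneg _) (norm_nonneg _) two_ne_zero).1 h

lemma orthogonalFamily_gaussianIsometry :
    OrthogonalFamily ℝ (fun _ : ι => E) (gaussianIsometry (ι := ι) E) := fun i j hij x y => by
  change ⟪(memLp_eval_smul i x).toLp, (memLp_eval_smul j y).toLp⟫_ℝ = 0
  rw [inner_toLp_eval_smul, integral_mul_eval_stdGaussianFamily hij, zero_mul]

/-- A square-summable family in a Hilbert space is the family of coefficients of a Gaussian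
random vector. -/
theorem exists_gaussian_measure [CompleteSpace E] [MeasurableSpace E] [BorelSpace E]
    (v : ι → E) (hv : Summable fun i => ‖v i‖ ^ 2) :
    ∃ ν : Measure E, IsProbabilityMeasure ν ∧
      ∀ b : E, ∫ z, cexp (I * (⟪b, z⟫_ℝ : ℝ)) ∂ν = Real.exp (-(1 / 2) * ∑' i, ⟪b, v i⟫_ℝ ^ 2) := by
  -- Orthogonal terms are summable in a complete space exactly when their squared norms are.
  have hsum : Summable fun i => gaussianIsometry E i (v i) :=
    (orthogonalFamily_gaussianIsometry.summable_iff_norm_sq_summable v).2 hv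
  obtain ⟨Z, hZ⟩ := hsum
  have hZm : AEMeasurable Z (stdGaussianFamily ι) :=
    (Lp.aestronglyMeasurable Z).aemeasurable
  refine ⟨(stdGaussianFamily ι).map Z, Measure.isProbabilityMeasure_map hZm, fun b => ?_⟩
  rw [integral_map hZm (by fun_prop)]
  -- Pairing with `b` is continuous into scalar `L²`, so the characteristic functions of the finite
  -- partial sums converge to that of `Z`.
  let L : Lp E 2 (stdGaussianFamily ι) →L[ℝ] Lp ℝ 2 (stdGaussianFamily ι) :=
    (innerSL ℝ b).compLpL 2 _
  have hL : ∀ Y : Lp E 2 (stdGaussianFamily ι), L Y =ᵐ[stdGaussianFamily ι] fun ω => ⟪b, Y ω⟫_ℝ :=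
    fun Y => (innerSL ℝ b).coeFn_compLpL Y
  have hLZ : Tendsto (fun s : Finset ι => L (∑ i ∈ s, gaussianIsometry E i (v i))) atTop
      (𝓝 (L Z)) := (L.continuous.tendsto _).comp hZ
  have h1 : Tendsto (fun s : Finset ι => ∫ ω, cexp (I * ((L (∑ i ∈ s, gaussianIsometry E i (v i)) :
      Lp ℝ 2 (stdGaussianFamily ι)) ω : ℝ)) ∂(stdGaussianFamily ι)) atTop
      (𝓝 (∫ ω, cexp (I * ((L Z) ω : ℝ)) ∂(stdGaussianFamily ι))) := by
    rw [tendsto_iff_norm_sub_tendsto_zero] at hLZ ⊢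
    exact squeeze_zero (fun _ => norm_nonneg _) (fun s => norm_integral_cexp_sub_le _ _ _) hLZ
  have h2 : ∀ s : Finset ι, ∫ ω, cexp (I * ((L (∑ i ∈ s, gaussianIsometry E i (v i)) :
      Lp ℝ 2 (stdGaussianFamily ι)) ω : ℝ)) ∂(stdGaussianFamily ι)
      = Real.exp (-(1 / 2) * ∑ i ∈ s, ⟪b, v i⟫_ℝ ^ 2) := fun s => by
    rw [← integral_cexp_sum_stdGaussianFamily]
    refine integral_congr_ae ?_
    have h3 : ∀ᵐ ω ∂(stdGaussianFamily ι), ∀ i ∈ s,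
        gaussianIsometry E i (v i) ω = ω i • v i :=
      (ae_ball_iff s.countable_toSet).2 fun i _ => (memLp_eval_smul i (v i)).coeFn_toLp
    filter_upwards [hL (∑ i ∈ s, gaussianIsometry E i (v i)), h3,
      Lp.coeFn_finsetSum s (fun i => gaussianIsometry E i (v i))] with ω h4 h5 h6
    rw [h4, h6, Finset.sum_apply, inner_sum]
    congr 3
    exact Finset.sum_congr rfl fun i hi => by rw [h5 i hi, real_inner_smul_right]
  have h7 : Summable fun i => ⟪b, v i⟫_ℝ ^ 2 := by
    refine Summable.of_nonneg_of_le (fun i => sq_nonneg _) (fun i => ?_) (hv.mul_left (‖b‖ ^ 2))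
    rw [← mul_pow, ← sq_abs]
    exact pow_le_pow_left₀ (abs_nonneg _) (abs_real_inner_le_norm _ _) 2
  have h8 : Tendsto (fun s : Finset ι => ((Real.exp (-(1 / 2) * ∑ i ∈ s, ⟪b, v i⟫_ℝ ^ 2) : ℝ) : ℂ))
      atTop (𝓝 (Real.exp (-(1 / 2) * ∑' i, ⟪b, v i⟫_ℝ ^ 2) : ℝ)) :=
    ((Complex.continuous_ofReal.comp (Real.continuous_exp.comp
      (continuous_const.mul continuous_id))).tendsto _).comp h7.hasSum
  simp_rw [h2] at h1
  rw [← tendsto_nhds_unique h1 h8]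
  refine integral_congr_ae ?_
  filter_upwards [hL Z] with ω hω
  rw [hω]

end
end GFF

/-! ### Hilbert–Schmidt operators given by kernels -/

namespace GFF

open MeasureTheory Filter Topology
open scoped InnerProductSpace ENNReal

section
variable {X : Type*} [MeasurableSpace X] {μ : Measure X}
  {H : Type*} [NormedAddCommGroup H] [InnerProductSpace ℝ H] [CompleteSpace H]

/-- Integration against a square-integrable `H`-valued kernel is a Hilbert–Schmidt operator
`L²(μ) → H`. -/
theorem exists_hilbertSchmidt_coefficients {u : X → H} (hu : MemLp u 2 μ) :
    ∃ (ι : Set H) (v : ι → Lp ℝ 2 μ), Summable (fun i => ‖v i‖ ^ 2) ∧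
      ∀ φ : Lp ℝ 2 μ, ∑' i, ⟪φ, v i⟫_ℝ ^ 2 = ‖∫ x, φ x • u x ∂μ‖ ^ 2 := by
  obtain ⟨w, e, -⟩ := exists_hilbertBasis ℝ H
  have hm : ∀ i, MemLp (fun x => ⟪e i, u x⟫_ℝ) 2 μ := fun i =>
    (innerSL ℝ (e i)).comp_memLp' hu
  refine ⟨w, fun i => (hm i).toLp, ?_, fun φ => ?_⟩
  · have hn : ∀ i, ‖(hm i).toLp‖ ^ 2 = ∫ x, ⟪e i, u x⟫_ℝ ^ 2 ∂μ := fun i => by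
      rw [← real_inner_self_eq_norm_sq, L2.inner_def]
      refine integral_congr_ae ?_
      filter_upwards [(hm i).coeFn_toLp] with x hx
      rw [hx, real_inner_self_eq_norm_sq, Real.norm_eq_abs, sq_abs]
    have hi : ∀ i, Integrable (fun x => ⟪e i, u x⟫_ℝ ^ 2) μ := fun i => (hm i).integrable_sq
    -- Bessel's inequality at each `x`, integrated, bounds every finite sum by the squared `L²` norm
    -- of the kernel.
    refine summable_of_sum_le (c := ∫ x, ‖u x‖ ^ 2 ∂μ) (fun i => sq_nonneg _) fun s => ?_
    simp_rw [hn]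
    rw [← integral_finsetSum _ fun i _ => hi i]
    refine integral_mono (integrable_finsetSum _ fun i _ => hi i) hu.norm.integrable_sq fun x => ?_
    simpa [Real.norm_eq_abs, sq_abs] using e.orthonormal.sum_inner_products_le (x := u x) (s := s)
  · have hint : Integrable (fun x => φ x • u x) μ := by
      exact (memLp_one_iff_integrable.1 (hu.smul (Lp.memLp φ)))
    -- These are the basis coefficients of `∫ φ u`, so Parseval finishes.
    have h : ∀ i, ⟪φ, (hm i).toLp⟫_ℝ = ⟪e i, ∫ x, φ x • u x ∂μ⟫_ℝ := fun i => by
      rw [← integral_inner hint, L2.inner_def]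
      refine integral_congr_ae ?_
      filter_upwards [(hm i).coeFn_toLp] with x hx
      rw [hx, real_inner_smul_right, real_inner_comm]; rfl
    simp_rw [h]
    have := e.tsum_inner_mul_inner (∫ x, φ x • u x ∂μ) (∫ x, φ x • u x ∂μ)
    rw [← real_inner_self_eq_norm_sq, ← this]
    refine tsum_congr fun i => ?_
    rw [pow_two, real_inner_comm]

end
end GFF

/-! ### Separability of Schwartz space -/

namespace GFF

open MeasureTheory Filter Topology TopologicalSpace
open scoped SchwartzMap

section Separable

variable {V F : Type*} [NormedAddCommGroup V] [NormedSpace ℝ V] [NormedAddCommGroup F]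
  [NormedSpace ℝ F]

/-- The jets of a Schwartz function, as continuous functions. -/
noncomputable def jets (f : 𝓢(V, F)) (n : ℕ) : C(V, V [×n]→L[ℝ] F) :=
  ⟨iteratedFDeriv ℝ n f, (f.smooth ⊤).continuous_iteratedFDeriv (by exact_mod_cast le_top)⟩

/-- The increasing sequence of Schwartz norms. -/
noncomputable def schwartzNorm (J : ℕ) : Seminorm ℝ 𝓢(V, F) :=
  (Finset.Iic (J, J)).sup (schwartzSeminormFamily ℝ V F)

lemma seminorm_le_schwartzNorm {k n J : ℕ} (hk : k ≤ J) (hn : n ≤ J) (f : 𝓢(V, F)) :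
    SchwartzMap.seminorm ℝ k n f ≤ schwartzNorm J f :=
  Seminorm.le_def.1 (Finset.le_sup (f := schwartzSeminormFamily ℝ V F)
    (Finset.mem_Iic.2 (Prod.mk_le_mk.2 ⟨hk, hn⟩))) f

lemma exists_sup_le_schwartzNorm (s : Finset (ℕ × ℕ)) :
    ∃ J, s.sup (schwartzSeminormFamily ℝ V F) ≤ schwartzNorm J := by
  refine ⟨s.sup (fun i => max i.1 i.2), Finset.sup_mono fun i hi => Finset.mem_Iic.2 ?_⟩
  have h : max i.1 i.2 ≤ s.sup (fun i => max i.1 i.2) :=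
    Finset.le_sup (f := fun i : ℕ × ℕ => max i.1 i.2) hi
  exact ⟨(le_max_left _ _).trans h, (le_max_right _ _).trans h⟩

lemma schwartzNorm_mono : Monotone (schwartzNorm (V := V) (F := F)) := fun _ _ h =>
  Finset.sup_mono (Finset.Iic_subset_Iic.2 ⟨h, h⟩)

lemma continuous_schwartzNorm (J : ℕ) : Continuous (schwartzNorm (V := V) (F := F) J) :=
  Seminorm.continuous_finsetSup fun i _ => (schwartz_withSeminorms ℝ V F).continuous_seminorm i

variable [FiniteDimensional ℝ V] [FiniteDimensional ℝ F]

instance secondCountableTopology_continuousMultilinearMap (n : ℕ) :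
    SecondCountableTopology (V [×n]→L[ℝ] F) := by
  have : FiniteDimensional ℝ (V [×n]→L[ℝ] F) :=
    FiniteDimensional.of_injective
      (ContinuousMultilinearMap.toMultilinearMapLinear :
        (V [×n]→L[ℝ] F) →ₗ[ℝ] MultilinearMap ℝ (fun _ : Fin n => V) F)
      ContinuousMultilinearMap.toMultilinearMap_injective
  have : ProperSpace (V [×n]→L[ℝ] F) := FiniteDimensional.proper ℝ _
  infer_instance

/-- A set of Schwartz functions bounded for one norm is separable for the previous one. -/
lemma exists_countable_schwartzNorm_dense_of_le (J M : ℕ) :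
    ∃ D : Set 𝓢(V, F), D.Countable ∧ ∀ f : 𝓢(V, F), schwartzNorm (J + 1) f ≤ M →
      ∀ ε > 0, ∃ d ∈ D, schwartzNorm J (f - d) ≤ ε := by
  let A := {f : 𝓢(V, F) // schwartzNorm (J + 1) f ≤ M}
  let Φ : A → ∀ n, C(V, V [×n]→L[ℝ] F) := fun f => jets f.1
  have : ∃ D : Set A, D.Countable ∧ ∀ f : A, Φ f ∈ closure (Φ '' D) := by
    let t : TopologicalSpace A := .induced Φ inferInstance
    -- Second countability, unlike separability, passes to subsets; the approximants must lie in `A`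
    -- so that they obey the bound `M` too.
    have ht : SecondCountableTopology A := secondCountableTopology_induced _ _ _
    obtain ⟨D, hD, hd⟩ := exists_countable_dense A
    refine ⟨D, hD, fun f => ?_⟩
    have hc : Continuous Φ := continuous_induced_dom
    exact image_closure_subset_closure_image hc ⟨f, hd f, rfl⟩
  obtain ⟨D, hD, hd⟩ := this
  refine ⟨Subtype.val '' D, hD.image _, fun f hf ε hε => ?_⟩
  -- Outside the ball of radius `R`, the spare power of `‖x‖` in the stronger norm gives the bound
  -- `2 * M / R ≤ ε`. Inside it, `‖x‖ ^ k ≤ R ^ J`, so local closeness `ε / R ^ J` suffices.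
  obtain ⟨R, hR1, hR2⟩ : ∃ R : ℝ, 1 ≤ R ∧ 2 * M ≤ ε * R :=
    ⟨max 1 (2 * M / ε), le_max_left _ _, by
      rw [← div_le_iff₀' hε]; exact le_max_right _ _⟩
  have hR0 : 0 < R := by linarith
  have hδ : 0 < ε / R ^ J := by positivity
  have hev : ∀ᶠ h in 𝓝 (jets f), ∀ n ∈ Finset.range (J + 1),
      ∀ x ∈ Metric.closedBall (0 : V) R, dist (jets f n x) (h n x) < ε / R ^ J := by
    have : ProperSpace V := FiniteDimensional.proper ℝ V
    rw [Finset.eventually_all]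
    intro n _
    have h1 : Tendsto (fun h : ∀ n, C(V, V [×n]→L[ℝ] F) => h n) (𝓝 (jets f)) (𝓝 (jets f n)) :=
      (continuous_apply n).tendsto _
    exact Metric.tendstoUniformlyOn_iff.1
      (ContinuousMap.tendsto_iff_forall_isCompact_tendstoUniformlyOn.1 h1 _
        (isCompact_closedBall _ _)) _ hδ
  obtain ⟨_, ⟨d, hdD, rfl⟩, hclose⟩ :=
    ((mem_closure_iff_frequently.1 (hd ⟨f, hf⟩)).and_eventually hev).exists
  refine ⟨d.1, ⟨d, hdD, rfl⟩, Seminorm.finset_sup_apply_le hε.le fun i hi => ?_⟩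
  obtain ⟨k, n⟩ := i
  obtain ⟨hk, hn⟩ := Prod.mk_le_mk.1 (Finset.mem_Iic.1 hi)
  refine SchwartzMap.seminorm_le_bound ℝ k n _ hε.le fun x => ?_
  by_cases hx : ‖x‖ ≤ R
  · have h2 := hclose n (Finset.mem_range.2 (by omega)) x (by simpa using hx)
    have h3 : iteratedFDeriv ℝ n (f - d.1 : 𝓢(V, F)) x = jets f n x - jets d.1 n x := by
      have := iteratedFDeriv_sub_apply (𝕜 := ℝ) (i := n) (x := x) (f := f) (g := d.1)
        (f.smooth n).contDiffAt (d.1.smooth n).contDiffAt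
      exact this
    rw [h3, ← dist_eq_norm]
    calc ‖x‖ ^ k * dist (jets f n x) (jets d.1 n x) ≤ R ^ J * (ε / R ^ J) := by
          refine mul_le_mul ?_ h2.le dist_nonneg (by positivity)
          exact (pow_le_pow_left₀ (norm_nonneg _) hx k).trans (pow_le_pow_right₀ hR1 hk)
      _ = ε := by field_simp
  · have hx' : R < ‖x‖ := not_le.1 hx
    have h4 : ‖x‖ ^ (k + 1) * ‖iteratedFDeriv ℝ n (f - d.1 : 𝓢(V, F)) x‖ ≤ 2 * M :=
      calc _ ≤ SchwartzMap.seminorm ℝ (k + 1) n (f - d.1) := SchwartzMap.le_seminorm ℝ _ _ _ _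
        _ ≤ schwartzNorm (J + 1) (f - d.1) := seminorm_le_schwartzNorm (by omega) (by omega) _
        _ ≤ schwartzNorm (J + 1) f + schwartzNorm (J + 1) d.1 := map_sub_le_add _ _ _
        _ ≤ 2 * M := by linarith [d.2]
    rw [pow_succ, mul_right_comm] at h4
    have h5 : 0 ≤ ‖x‖ ^ k * ‖iteratedFDeriv ℝ n (f - d.1 : 𝓢(V, F)) x‖ := by positivity
    nlinarith [mul_le_mul_of_nonneg_left hx'.le h5]

/-- The Schwartz space is separable. -/
instance separableSpace_schwartzMap : SeparableSpace 𝓢(V, F) := by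
  choose D hD hd using exists_countable_schwartzNorm_dense_of_le (V := V) (F := F)
  refine ⟨⋃ J, ⋃ M, D J M, Set.countable_iUnion fun J => Set.countable_iUnion fun M => hD J M,
    fun f => mem_closure_iff_nhds.2 fun U hU => ?_⟩
  obtain ⟨s, r, hr, hsU⟩ := ((schwartz_withSeminorms ℝ V F).mem_nhds_iff f U).1 hU
  obtain ⟨J, hJ⟩ := exists_sup_le_schwartzNorm (V := V) (F := F) s
  obtain ⟨M, hM⟩ := exists_nat_ge (schwartzNorm (J + 1) f)
  obtain ⟨d, hdD, hfd⟩ := hd J M f hM (r / 2) (by positivity)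
  refine ⟨d, hsU ?_, Set.mem_iUnion₂.2 ⟨J, M, hdD⟩⟩
  rw [Seminorm.mem_ball, map_sub_rev]
  exact ((Seminorm.le_def.1 hJ _).trans hfd).trans_lt (by linarith)

end Separable

/-! ### Borel sets of the dual and uniqueness of the measure -/

/-- The cylinder σ-algebra on `S'(ℝ⁴)`. -/
noncomputable abbrev cylinderMeasurableSpace : MeasurableSpace TemperedDual :=
  MeasurableSpace.comap (fun (φ : TemperedDual) (f : TestFunction) => φ f) MeasurableSpace.pi

/-- The distributions bounded by `n` times the `n`-th Schwartz norm. -/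
noncomputable def boundedDual (n : ℕ) : Set TemperedDual := {φ | ∀ f : TestFunction, |φ f| ≤ n * schwartzNorm n f}

/-- Continuity bounds `φ` by a constant times a finite supremum of seminorms. One index can serve as
both constant and order, since the bound weakens as either grows. -/
lemma iUnion_boundedDual : ⋃ n, boundedDual n = Set.univ := by
  refine Set.eq_univ_of_forall fun φ => Set.mem_iUnion.2 ?_
  let q : Seminorm ℝ TestFunction := (normSeminorm ℝ ℝ).comp (φ : TestFunction →L[ℝ] ℝ).toLinearMap
  have hq : Continuous q := continuous_norm.comp φ.continuous
  obtain ⟨s, C, -, hC⟩ := Seminorm.bound_of_continuous (schwartz_withSeminorms ℝ _ _) q hq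
  obtain ⟨J, hJ⟩ := exists_sup_le_schwartzNorm (V := Spacetime) (F := ℝ) s
  obtain ⟨N, hN⟩ := exists_nat_ge (C : ℝ)
  refine ⟨max J N, fun f => ?_⟩
  calc |φ f| ≤ C * s.sup (schwartzSeminormFamily ℝ _ _) f := Seminorm.le_def.1 hC f
    _ ≤ (max J N : ℕ) * schwartzNorm (max J N) f := by
      refine mul_le_mul (hN.trans (by exact_mod_cast le_max_right _ _))
        ((Seminorm.le_def.1 hJ f).trans (Seminorm.le_def.1 (schwartzNorm_mono (le_max_left _ _)) f))
        (apply_nonneg _ _) (by positivity)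

lemma measurable_eval_cylinder (f : TestFunction) :
    Measurable[cylinderMeasurableSpace] (fun φ : TemperedDual => φ f) :=
  (measurable_pi_apply f).comp (comap_measurable _)

/-- On an equicontinuous set the weak-* topology is the topology of pointwise convergence on a
dense set. -/
lemma exists_isOpen_inter_boundedDual {D : Set TestFunction} (hD : Dense D) (n : ℕ)
    {U : Set TemperedDual} (hU : IsOpen U) :
    ∃ W : Set (D → ℝ), IsOpen W ∧
      U ∩ boundedDual n = {φ | (fun d : D => φ d.1) ∈ W} ∩ boundedDual n := by
  let r : boundedDual n → (D → ℝ) := fun φ d => φ.1 d.1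
  have hopen : IsOpen[.induced r inferInstance] (Subtype.val ⁻¹' U : Set (boundedDual n)) := by
    let t : TopologicalSpace (boundedDual n) := .induced r inferInstance
    have hr : Continuous r := continuous_induced_dom
    refine hU.preimage (WeakBilin.continuous_of_continuous_eval _ fun f => ?_)
    -- On `boundedDual n`, evaluation at `f` is a uniform limit of evaluations at points `d` of `D`,
    -- since `|φ (f - d)| ≤ n * schwartzNorm n (f - d)`.
    refine continuous_of_uniform_approx_of_continuous fun u hu => ?_
    obtain ⟨ε, hε, hεu⟩ := Metric.mem_uniformity_dist.1 hu
    have hc : Continuous fun d : TestFunction => n * schwartzNorm n (f - d) :=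
      continuous_const.mul ((continuous_schwartzNorm n).comp (continuous_const.sub continuous_id))
    obtain ⟨d, hd, hdε⟩ := hD.exists_mem_open (hc.isOpen_preimage _ (isOpen_gt' ε))
      ⟨f, by simpa using hε⟩
    refine ⟨fun φ => φ.1 d, (continuous_apply (⟨d, hd⟩ : D)).comp hr, fun φ => hεu ?_⟩
    have h1 := φ.2 (f - d)
    rw [map_sub] at h1
    exact (Real.dist_eq _ _).trans_lt (h1.trans_lt hdε)
  obtain ⟨W, hW, hWU⟩ := isOpen_induced_iff.1 hopen
  refine ⟨W, hW, Set.ext fun φ => and_congr_left fun hφ => ?_⟩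
  exact (Set.ext_iff.1 hWU ⟨φ, hφ⟩).symm

/-- The Borel σ-algebra of the weak-* topology is the cylinder σ-algebra. -/
lemma borel_temperedDual_le_cylinder : borel TemperedDual ≤ cylinderMeasurableSpace := by
  obtain ⟨D, hDc, hD⟩ := exists_countable_dense TestFunction
  have : Countable D := hDc.to_subtype
  let m : MeasurableSpace TemperedDual := cylinderMeasurableSpace
  have hr : Measurable[m] (fun (φ : TemperedDual) (d : D) => φ d.1) :=
    measurable_pi_iff.2 fun d => measurable_eval_cylinder d.1
  have hK : ∀ n, MeasurableSet[m] (boundedDual n) := fun n => by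
    -- Both sides of the bound are continuous in the test function, so it need only be checked on
    -- the countable dense set.
    have h : boundedDual n = ⋂ d : D, {φ : TemperedDual | |φ d.1| ≤ n * schwartzNorm n d.1} := by
      ext φ
      simp only [boundedDual, Set.mem_ofPred_eq, Set.mem_iInter]
      refine ⟨fun h d => h d, fun h f => ?_⟩
      have hcl : IsClosed {f : TestFunction | |φ f| ≤ n * schwartzNorm n f} :=
        isClosed_le (continuous_abs.comp φ.continuous)
          (continuous_const.mul (continuous_schwartzNorm n))
      exact hcl.closure_subset_iff.2 (fun d hd => h ⟨d, hd⟩) (hD f)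
    rw [h]
    exact MeasurableSet.iInter fun d =>
      measurableSet_le (continuous_abs.measurable.comp (measurable_eval_cylinder d.1))
        measurable_const
  refine MeasurableSpace.generateFrom_le fun U hU => ?_
  choose W hW hWU using fun n => exists_isOpen_inter_boundedDual hD n hU
  have h : U = ⋃ n, U ∩ boundedDual n := by
    rw [← Set.inter_iUnion, iUnion_boundedDual, Set.inter_univ]
  rw [h]
  refine MeasurableSet.iUnion fun n => ?_
  rw [hWU n]
  exact (hr (hW n).measurableSet).inter (hK n)

/-- A linear combination of evaluations of `φ` is its evaluation at one test function, so the
characteristic functional already contains every joint law. -/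
lemma charFunDual_map_evals (μ : Measure TemperedDual) (I : Finset TestFunction)
    [DecidableEq I] (L : StrongDual ℝ (I → ℝ)) :
    charFunDual (μ.map fun (φ : TemperedDual) (i : I) => φ i.1) L
      = charFunctional μ (∑ i : I, L (Pi.single i 1) • i.1) := by
  have he : ∀ f : TestFunction, Measurable fun φ : TemperedDual => φ f := fun f =>
    (WeakDual.eval_continuous f).measurable
  have hev : Measurable fun (φ : TemperedDual) (i : I) => φ i.1 :=
    measurable_pi_iff.2 fun i => he i.1
  rw [charFunDual_apply, integral_map hev.aemeasurable (by fun_prop)]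
  refine integral_congr_ae (ae_of_all _ fun φ => ?_)
  have h : L (fun i : I => φ i.1) = φ (∑ i : I, L (Pi.single i 1) • i.1) := by
    rw [map_sum]
    refine (LinearMap.pi_apply_eq_sum_univ (L : (I → ℝ) →ₗ[ℝ] ℝ) (fun i : I => φ i.1)).trans ?_
    refine Finset.sum_congr rfl fun i _ => ?_
    have hs : (fun j => if i = j then (1 : ℝ) else 0) = Pi.single i 1 := by
      ext j
      simp [Pi.single_apply, eq_comm]
    rw [hs, map_smul, smul_eq_mul, smul_eq_mul, mul_comm]
    rfl
  simp only [h, mul_comm]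

/-- A probability measure on `S'(ℝ⁴)` is determined by its characteristic functional. -/
theorem ext_of_charFunctional {μ ν : Measure TemperedDual} [IsProbabilityMeasure μ]
    [IsProbabilityMeasure ν] (h : ∀ f, charFunctional μ f = charFunctional ν f) : μ = ν := by
  classical
  let ev : TemperedDual → TestFunction → ℝ := fun φ f => φ f
  have hev : Measurable ev := measurable_pi_iff.2 fun f => (WeakDual.eval_continuous f).measurable
  have hmap : μ.map ev = ν.map ev := by
    have := Measure.isProbabilityMeasure_map (μ := ν) hev.aemeasurable
    refine IsProjectiveLimit.unique (P := fun I => (ν.map ev).map I.restrict) (fun I => ?_) fun I => rfl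
    have := Measure.isProbabilityMeasure_map (μ := μ) hev.aemeasurable
    have := Measure.isProbabilityMeasure_map (μ := μ.map ev)
      (Finset.measurable_restrict I (X := fun _ : TestFunction => ℝ)).aemeasurable
    have := Measure.isProbabilityMeasure_map (μ := ν.map ev)
      (Finset.measurable_restrict I (X := fun _ : TestFunction => ℝ)).aemeasurable
    refine Measure.ext_of_charFunDual (funext fun L => ?_)
    beta_reduce
    rw [Measure.map_map (Finset.measurable_restrict I) hev,
      Measure.map_map (Finset.measurable_restrict I) hev]
    exact (charFunDual_map_evals μ I L).trans ((h _).trans (charFunDual_map_evals ν I L).symm)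
  ext A hA
  obtain ⟨B, hB, rfl⟩ := borel_temperedDual_le_cylinder A hA
  rw [← Measure.map_apply hev hB, ← Measure.map_apply hev hB, hmap]

end GFF

/-! ### The propagator as an integral of heat kernels -/

namespace GFF

open MeasureTheory Filter Topology
open scoped FourierTransform RealInnerProductSpace

/-- Since `cosh u ≥ u² / 4`, completing the square gives the Gaussian majorant: `u - z u² / 4 ≤ 2 /
z - z u² / 8`. -/
lemma integrable_exp_mul_exp_neg_mul_cosh {z : ℝ} (hz : 0 < z) :
    Integrable fun u : ℝ => Real.exp u * Real.exp (-z * Real.cosh u) := by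
  have hg : Integrable fun u : ℝ => Real.exp (2 / z) * Real.exp (-(z / 8) * u ^ 2) :=
    (integrable_exp_neg_mul_sq (by positivity)).const_mul _
  refine hg.mono' (by fun_prop) (ae_of_all _ fun u => ?_)
  rw [← Real.exp_add, ← Real.exp_add, Real.norm_eq_abs, Real.abs_exp, Real.exp_le_exp]
  have h1 : u ^ 2 / 4 ≤ Real.cosh u := by
    rw [← Real.cosh_abs, Real.cosh_eq, ← sq_abs]
    have := Real.quadratic_le_exp_of_nonneg (abs_nonneg u)
    have := Real.exp_pos (-|u|)
    have := abs_nonneg u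
    linarith
  have h2 : z * (u ^ 2 / 4) ≤ z * Real.cosh u := mul_le_mul_of_nonneg_left h1 hz.le
  have h3 : 2 / z + z * u ^ 2 / 8 - u = (2 / z) * (1 - z * u / 4) ^ 2 := by field_simp; ring
  have h4 : 0 ≤ (2 / z) * (1 - z * u / 4) ^ 2 := by positivity
  linarith

/-- Averaging over `u ↦ -u` replaces `exp (-u)` by `cosh u`; the integrand is then even, whence the
factor 2. -/
lemma integral_exp_neg_mul_exp_neg_mul_cosh {z : ℝ} (hz : 0 < z) :
    ∫ u : ℝ, Real.exp (-u) * Real.exp (-z * Real.cosh u) = 2 * besselK 1 z := by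
  have h1 := integrable_exp_mul_exp_neg_mul_cosh hz
  have h2 : Integrable fun u : ℝ => Real.exp (-u) * Real.exp (-z * Real.cosh u) := by
    simpa using h1.comp_neg
  have h3 : ∫ u : ℝ, Real.exp u * Real.exp (-z * Real.cosh u)
      = ∫ u : ℝ, Real.exp (-u) * Real.exp (-z * Real.cosh u) := by
    rw [← integral_neg_eq_self]; simp
  have h4 : ∫ u : ℝ, Real.exp (-z * Real.cosh |u|) * Real.cosh (1 * |u|)
      = ∫ u : ℝ, Real.exp (-u) * Real.exp (-z * Real.cosh u) := by
    have : ∀ u : ℝ, Real.exp (-z * Real.cosh |u|) * Real.cosh (1 * |u|)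
        = (Real.exp u * Real.exp (-z * Real.cosh u)
          + Real.exp (-u) * Real.exp (-z * Real.cosh u)) / 2 := fun u => by
      rw [one_mul, Real.cosh_abs, Real.cosh_eq u]; ring
    simp_rw [this]
    rw [integral_div, integral_add h1 h2, h3]; ring
  rw [← h4, besselK, integral_comp_abs (f := fun u => Real.exp (-z * Real.cosh u) * Real.cosh (1 * u))]

/-- The massive heat kernel `e^{-m²t} (4πt)⁻² e^{-r²/4t}` of `ℝ⁴` at time `t` and distance `r`. -/
noncomputable def massiveHeatKernel (m t r : ℝ) : ℝ :=
  Real.exp (-(m ^ 2 * t)) * ((4 * Real.pi * t) ^ 2)⁻¹ * Real.exp (-(4 * t)⁻¹ * r ^ 2)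

/-- The free propagator is the time integral of the massive heat kernel. -/
lemma integral_massiveHeatKernel {m r : ℝ} (hm : 0 < m) (hr : 0 < r) :
    ∫ t in Set.Ioi (0 : ℝ), massiveHeatKernel m t r
      = m / (4 * Real.pi ^ 2 * r) * besselK 1 (m * r) := by
  -- The substitution `t = (r / 2m) exp u` turns `m² t + r² / 4t` into `m r cosh u`; the Jacobian
  -- against `t⁻²` leaves `exp (-u)`.
  have hc : 0 < r / (2 * m) := by positivity
  have himg : (fun u : ℝ => r / (2 * m) * Real.exp u) '' Set.univ = Set.Ioi 0 := by
    ext t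
    simp only [Set.image_univ, Set.mem_range, Set.mem_Ioi]
    constructor
    · rintro ⟨u, rfl⟩; positivity
    · intro ht
      refine ⟨Real.log (t / (r / (2 * m))), ?_⟩
      rw [Real.exp_log (by positivity)]; field_simp
  have h := integral_image_eq_integral_abs_deriv_smul (s := Set.univ)
    (f := fun u : ℝ => r / (2 * m) * Real.exp u) (f' := fun u => r / (2 * m) * Real.exp u)
    MeasurableSet.univ
    (fun u _ => ((Real.hasDerivAt_exp u).const_mul _).hasDerivWithinAt)
    (fun a _ b _ hab => Real.exp_injective (mul_left_cancel₀ hc.ne' hab))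
    (fun t => massiveHeatKernel m t r)
  rw [himg, Measure.restrict_univ] at h
  rw [h]
  have h2 : ∀ u : ℝ, |r / (2 * m) * Real.exp u| • massiveHeatKernel m (r / (2 * m) * Real.exp u) r
      = m / (8 * Real.pi ^ 2 * r) * (Real.exp (-u) * Real.exp (-(m * r) * Real.cosh u)) := fun u => by
    rw [abs_of_pos (by positivity), smul_eq_mul, massiveHeatKernel]
    have e1 : Real.exp (-(m * r) * Real.cosh u)
        = Real.exp (-(m ^ 2 * (r / (2 * m) * Real.exp u)))
          * Real.exp (-(4 * (r / (2 * m) * Real.exp u))⁻¹ * r ^ 2) := by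
      rw [← Real.exp_add, Real.cosh_eq, Real.exp_neg u]
      congr 1
      have := (Real.exp_pos u).ne'
      field_simp
      ring
    rw [e1, Real.exp_neg u]
    have := (Real.exp_pos u).ne'
    generalize Real.exp (-(m ^ 2 * (r / (2 * m) * Real.exp u))) = a
    generalize Real.exp (-(4 * (r / (2 * m) * Real.exp u))⁻¹ * r ^ 2) = b
    field_simp
    ring
  simp_rw [h2]
  rw [integral_const_mul, integral_exp_neg_mul_exp_neg_mul_cosh (by positivity)]
  field_simp
  ring

lemma continuousOn_massiveHeatKernel (m : ℝ) :
    ContinuousOn (fun p : ℝ × Spacetime => massiveHeatKernel m p.1 ‖p.2‖)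
      (Set.Ioi 0 ×ˢ Set.univ) := by
  unfold massiveHeatKernel
  have h4 : ∀ p ∈ (Set.Ioi (0 : ℝ) ×ˢ (Set.univ : Set Spacetime)), 0 < p.1 := fun p hp => hp.1
  have hπ := Real.pi_pos
  refine ContinuousOn.mul (ContinuousOn.mul (by fun_prop) (ContinuousOn.inv₀ (by fun_prop) ?_))
    (Real.continuous_exp.comp_continuousOn (ContinuousOn.mul (ContinuousOn.neg
      (ContinuousOn.inv₀ (by fun_prop) ?_)) (by fun_prop)))
  · intro p hp; have := h4 p hp; positivity
  · intro p hp; have := h4 p hp; positivity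

lemma aestronglyMeasurable_massiveHeatKernel (m : ℝ) :
    AEStronglyMeasurable (fun p : ℝ × Spacetime => massiveHeatKernel m p.1 ‖p.2‖)
      ((volume.restrict (Set.Ioi 0)).prod volume) := by
  have h := (continuousOn_massiveHeatKernel m).aestronglyMeasurable (μ := volume.prod volume)
    (measurableSet_Ioi.prod MeasurableSet.univ)
  rwa [← Measure.prod_restrict, Measure.restrict_univ] at h

lemma fourier_massiveHeatKernel (m : ℝ) {t : ℝ} (ht : 0 < t) (w : Spacetime) :
    𝓕 (fun z : Spacetime => (massiveHeatKernel m t ‖z‖ : ℂ)) w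
      = (Real.exp (-((m ^ 2 + 4 * Real.pi ^ 2 * ‖w‖ ^ 2) * t)) : ℝ) := by
  have h := fourier_gaussian_innerProductSpace (V := Spacetime) (b := ((4 * t)⁻¹ : ℝ))
    (by rw [Complex.ofReal_re]; positivity) w
  have hfun : 𝓕 (fun z : Spacetime => (massiveHeatKernel m t ‖z‖ : ℂ)) w
      = ((Real.exp (-(m ^ 2 * t)) * ((4 * Real.pi * t) ^ 2)⁻¹ : ℝ) : ℂ) *
        𝓕 (fun z : Spacetime => Complex.exp (-((4 * t)⁻¹ : ℝ) * ‖z‖ ^ 2)) w := by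
    rw [Real.fourier_eq, Real.fourier_eq, ← integral_const_mul]
    congr 1
    ext z
    simp only [massiveHeatKernel, Circle.smul_def, smul_eq_mul]
    push_cast
    ring
  have hdim : (Module.finrank ℝ Spacetime / 2 : ℂ) = (2 : ℕ) := by simp; norm_num
  have hπ : (Real.pi : ℂ) ≠ 0 := by exact_mod_cast Real.pi_ne_zero
  have ht' : (t : ℂ) ≠ 0 := by exact_mod_cast ht.ne'
  rw [hfun, h, hdim, Complex.cpow_natCast]
  have he : (Real.exp (-((m ^ 2 + 4 * Real.pi ^ 2 * ‖w‖ ^ 2) * t)) : ℝ)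
      = Real.exp (-(m ^ 2 * t)) * Real.exp (-Real.pi ^ 2 * ‖w‖ ^ 2 / (4 * t)⁻¹) := by
    rw [← Real.exp_add]; congr 1; field_simp; ring
  rw [he]
  push_cast
  generalize Complex.exp (-(Real.pi : ℂ) ^ 2 * (‖w‖ : ℂ) ^ 2 / (4 * (t : ℂ))⁻¹) = a
  generalize Complex.exp (-((m : ℂ) ^ 2 * t)) = b
  field_simp

lemma integral_massiveHeatKernel_space (m : ℝ) {t : ℝ} (ht : 0 < t) :
    ∫ z : Spacetime, massiveHeatKernel m t ‖z‖ = Real.exp (-(m ^ 2 * t)) := by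
  unfold massiveHeatKernel
  rw [integral_const_mul, GaussianFourier.integral_rexp_neg_mul_sq_norm (by positivity)]
  have : (Module.finrank ℝ Spacetime / 2 : ℝ) = (2 : ℕ) := by simp; norm_num
  rw [this, Real.rpow_natCast]
  have := Real.pi_pos
  field_simp

lemma integrable_massiveHeatKernel_space (m : ℝ) {t : ℝ} (ht : 0 < t) :
    Integrable fun z : Spacetime => massiveHeatKernel m t ‖z‖ := by
  -- A non-integrable function has integral 0 by convention, while this integral is positive.
  refine not_imp_comm.1 integral_undef ?_
  rw [integral_massiveHeatKernel_space m ht]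
  positivity

lemma massiveHeatKernel_nonneg (m t r : ℝ) : 0 ≤ massiveHeatKernel m t r := by
  unfold massiveHeatKernel; positivity

/-- The spatial integral at time `t` is `exp (-m² t)`, integrable in time because `m > 0`. This
justifies Fubini for the propagator and its Fourier transform. -/
lemma integrable_massiveHeatKernel {m : ℝ} (hm : 0 < m) :
    Integrable (fun p : ℝ × Spacetime => massiveHeatKernel m p.1 ‖p.2‖)
      ((volume.restrict (Set.Ioi 0)).prod volume) := by
  rw [integrable_prod_iff (aestronglyMeasurable_massiveHeatKernel m)]
  constructor
  · filter_upwards [ae_restrict_mem measurableSet_Ioi] with t ht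
    exact integrable_massiveHeatKernel_space m ht
  · have h : IntegrableOn (fun t => Real.exp (-(m ^ 2) * t)) (Set.Ioi 0) :=
      integrableOn_exp_mul_Ioi (by nlinarith) 0
    refine h.congr ?_
    filter_upwards [ae_restrict_mem measurableSet_Ioi] with t ht
    simp_rw [Real.norm_of_nonneg (massiveHeatKernel_nonneg _ _ _)]
    rw [integral_massiveHeatKernel_space m ht, neg_mul]

/-- The free propagator as a function of the difference. -/
noncomputable def propagator (m : ℝ) (z : Spacetime) : ℝ := freePropagator m z 0

lemma freePropagator_eq (m : ℝ) (x y : Spacetime) : freePropagator m x y = propagator m (x - y) := by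
  simp [propagator, freePropagator]

lemma propagator_ae_eq {m : ℝ} (hm : 0 < m) :
    propagator m =ᵐ[volume] fun z => ∫ t in Set.Ioi (0 : ℝ), massiveHeatKernel m t ‖z‖ := by
  have h0 : ∀ᵐ z : Spacetime, z ≠ 0 := by
    simp [ae_iff]
  filter_upwards [h0] with z hz
  rw [integral_massiveHeatKernel hm (norm_pos_iff.2 hz)]
  simp [propagator, freePropagator]

lemma integrable_propagator {m : ℝ} (hm : 0 < m) : Integrable (propagator m) :=
  (integrable_massiveHeatKernel hm).integral_prod_right.congr (propagator_ae_eq hm).symm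

lemma fourier_propagator {m : ℝ} (hm : 0 < m) (w : Spacetime) :
    𝓕 (fun z => (propagator m z : ℂ)) w = ((m ^ 2 + 4 * Real.pi ^ 2 * ‖w‖ ^ 2)⁻¹ : ℝ) := by
  rw [Real.fourier_eq]
  have h1 : ∫ z, 𝐞 (-⟪z, w⟫) • (propagator m z : ℂ)
      = ∫ z, ∫ t in Set.Ioi (0 : ℝ), 𝐞 (-⟪z, w⟫) • (massiveHeatKernel m t ‖z‖ : ℂ) := by
    refine integral_congr_ae ?_
    filter_upwards [propagator_ae_eq hm] with z hz
    rw [hz, ← integral_complex_ofReal, Circle.smul_def, ← integral_smul]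
    rfl
  have h2 : Integrable (fun p : Spacetime × ℝ => 𝐞 (-⟪p.1, w⟫) • (massiveHeatKernel m p.2 ‖p.1‖ : ℂ))
      (volume.prod (volume.restrict (Set.Ioi 0))) := by
    have h3 := (integrable_massiveHeatKernel hm).swap.ofReal (𝕜 := ℂ)
    refine h3.norm.mono' ?_ (ae_of_all _ fun p => ?_)
    · exact (by fun_prop : Continuous fun p : Spacetime × ℝ => 𝐞 (-⟪p.1, w⟫)).aestronglyMeasurable.smul h3.1
    · rw [Circle.norm_smul]; rfl
  rw [h1, integral_integral_swap h2]
  have h4 : ∫ t in Set.Ioi (0 : ℝ), ∫ z, 𝐞 (-⟪z, w⟫) • (massiveHeatKernel m t ‖z‖ : ℂ)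
      = ∫ t in Set.Ioi (0 : ℝ), ((Real.exp (-(m ^ 2 + 4 * Real.pi ^ 2 * ‖w‖ ^ 2) * t) : ℝ) : ℂ) := by
    refine setIntegral_congr_fun measurableSet_Ioi fun t ht => ?_
    beta_reduce
    rw [← Real.fourier_eq, fourier_massiveHeatKernel m ht, neg_mul]
  have h5 : 0 < m ^ 2 + 4 * Real.pi ^ 2 * ‖w‖ ^ 2 := by positivity
  rw [h4, integral_complex_ofReal, integral_exp_mul_Ioi (by linarith), mul_zero, Real.exp_zero,
    neg_div_neg_eq, one_div]

end GFF

/-! ### The covariance as an inner product -/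

namespace GFF

open MeasureTheory Filter Topology
open scoped FourierTransform RealInnerProductSpace SchwartzMap Convolution ComplexConjugate

/-- Both `g` and the propagator are integrable, hence so is the convolution integrand; `f` is a
bounded factor. -/
lemma integrable_covarianceIntegrand {m : ℝ} (hm : 0 < m) (f g : TestFunction) :
    Integrable (covarianceIntegrand m f g) volume := by
  have h := (g.integrable (μ := volume)).convolution_integrand (ContinuousLinearMap.mul ℝ ℝ)
    (integrable_propagator hm)
  have h2 := h.bdd_mul (f := fun p : Spacetime × Spacetime => f p.1)
    (c := SchwartzMap.seminorm ℝ 0 0 f) (by fun_prop)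
    (ae_of_all _ fun p => SchwartzMap.norm_le_seminorm ℝ f p.1)
  refine h2.congr (ae_of_all _ fun p => ?_)
  simp only [covarianceIntegrand, freePropagator_eq, ContinuousLinearMap.mul_apply']
  ring

/-- The complexification of a real test function. -/
noncomputable def complexify : TestFunction →L[ℝ] 𝓢(Spacetime, ℂ) :=
  SchwartzMap.postcompCLM Complex.ofRealCLM

@[simp] lemma complexify_apply (f : TestFunction) (x : Spacetime) : complexify f x = f x := rfl

lemma fourierInv_complexify (f : TestFunction) (w : Spacetime) :
    𝓕⁻ (complexify f) w = conj (𝓕 (complexify f) w) := by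
  rw [SchwartzMap.fourierInv_coe, SchwartzMap.fourier_coe, Real.fourierInv_eq, Real.fourier_eq,
    ← integral_conj]
  congr 1
  ext x
  simp [Circle.smul_def, ← Circle.coe_inv_eq_conj, ← AddChar.map_neg_eq_inv]

/-- The spectral density `1 / (m² + 4π²|w|²)` of the free field. -/
noncomputable def spectralDensity (m : ℝ) (w : Spacetime) : ℝ :=
  (m ^ 2 + 4 * Real.pi ^ 2 * ‖w‖ ^ 2)⁻¹

/-- The free covariance in Fourier space. -/
lemma freeCovariance_eq_fourier {m : ℝ} (hm : 0 < m) (f g : TestFunction) :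
    (freeCovariance m f g : ℂ)
      = ∫ w, conj (𝓕 (complexify f) w) * (spectralDensity m w * 𝓕 (complexify g) w) := by
  let k : Spacetime → ℂ := fun z => propagator m z
  have hk : Integrable k := (integrable_propagator hm).ofReal
  have hg : Integrable (complexify g) := (complexify g).integrable
  have h1 : (freeCovariance m f g : ℂ)
      = ∫ x, complexify f x * (complexify g ⋆[ContinuousLinearMap.mul ℂ ℂ] k) x := by
    rw [freeCovariance, Measure.volume_eq_prod,
      integral_prod _ (integrable_covarianceIntegrand hm f g), ← integral_complex_ofReal]
    congr 1
    ext x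
    rw [convolution_def, ← integral_complex_ofReal, ← integral_const_mul]
    congr 1
    ext y
    simp only [covarianceIntegrand, freePropagator_eq, ContinuousLinearMap.mul_apply',
      complexify_apply, k]
    push_cast
    ring
  have hconv : Integrable (complexify g ⋆[ContinuousLinearMap.mul ℂ ℂ] k) :=
    hg.integrable_convolution _ hk
  -- Moving the outer transform across the integral uses only integrability of the convolution.
  have h2 : complexify f = 𝓕 (𝓕⁻ (complexify f)) := by simp
  have h3 : ∫ x, complexify f x * (complexify g ⋆[ContinuousLinearMap.mul ℂ ℂ] k) x
      = ∫ w, 𝓕⁻ (complexify f) w * 𝓕 (complexify g ⋆[ContinuousLinearMap.mul ℂ ℂ] k) w := by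
    conv_lhs => rw [h2]
    have := VectorFourier.integral_fourierIntegral_smul_eq_flip (μ := volume) (ν := volume)
      (L := innerₗ Spacetime) (f := ⇑(𝓕⁻ (complexify f) : 𝓢(Spacetime, ℂ))) Real.continuous_fourierChar
      continuous_inner (𝓕⁻ (complexify f) : 𝓢(Spacetime, ℂ)).integrable hconv
    rw [flip_innerₗ] at this
    exact this
  rw [h1, h3]
  congr 1
  ext w
  rw [Real.fourier_mul_convolution_eq hg hk, fourier_propagator hm, fourierInv_complexify,
    spectralDensity, mul_comm (𝓕 (⇑(complexify g)) w)]
  rfl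

/-- The square root of the spectral density. -/
noncomputable def spectralRoot (m : ℝ) (w : Spacetime) : ℝ :=
  m⁻¹ * (1 + ‖((2 * Real.pi / m) • w)‖ ^ 2) ^ (-(1 / 2) : ℝ)

lemma spectralRoot_mul_self {m : ℝ} (hm : 0 < m) (w : Spacetime) :
    spectralRoot m w * spectralRoot m w = spectralDensity m w := by
  have h : 0 < 1 + ‖((2 * Real.pi / m) • w)‖ ^ 2 := by positivity
  rw [spectralRoot, mul_mul_mul_comm, ← Real.rpow_add h]
  norm_num
  rw [Real.rpow_neg_one, spectralDensity, ← mul_inv, ← mul_inv, norm_smul, Real.norm_eq_abs, mul_pow, sq_abs]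
  congr 1
  field_simp
  ring

/-- Written as a power of `1 + |·|²` after a dilation, the root is a composition of temperate
functions. -/
lemma hasTemperateGrowth_spectralRoot (m : ℝ) : (spectralRoot m).HasTemperateGrowth := by
  have h : (fun w : Spacetime => (2 * Real.pi / m) • w).HasTemperateGrowth := by fun_prop
  have h2 := (Function.hasTemperateGrowth_one_add_norm_sq_rpow Spacetime (-(1 / 2))).comp h
  exact (Function.HasTemperateGrowth.const m⁻¹).mul h2

/-- The map `f ↦ √ρ f̂` from test functions to the one-particle space. -/
noncomputable def oneParticleMap (m : ℝ) : TestFunction →L[ℝ] Lp ℂ 2 (volume : Measure Spacetime) :=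
  SchwartzMap.toLpCLM ℝ ℂ 2 volume ∘L SchwartzMap.smulLeftCLM ℂ (spectralRoot m) ∘L
    FourierTransform.fourierCLM ℝ 𝓢(Spacetime, ℂ) ∘L complexify

lemma coeFn_oneParticleMap (m : ℝ) (f : TestFunction) :
    oneParticleMap m f =ᵐ[volume] fun w => spectralRoot m w • 𝓕 (complexify f) w := by
  refine (SchwartzMap.coeFn_toLp _ 2 volume).trans (ae_of_all _ fun w => ?_)
  exact SchwartzMap.smulLeftCLM_apply_apply (hasTemperateGrowth_spectralRoot m) _ w

/-- The free covariance is the inner product of the one-particle space. -/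
lemma freeCovariance_eq_inner {m : ℝ} (hm : 0 < m) (f g : TestFunction) :
    freeCovariance m f g = ⟪oneParticleMap m f, oneParticleMap m g⟫ := by
  have h1 : inner ℂ (oneParticleMap m f) (oneParticleMap m g) = (freeCovariance m f g : ℂ) := by
    rw [freeCovariance_eq_fourier hm, L2.inner_def]
    refine integral_congr_ae ?_
    filter_upwards [coeFn_oneParticleMap m f, coeFn_oneParticleMap m g] with w hf hg
    rw [hf, hg, ← spectralRoot_mul_self hm, RCLike.inner_apply]
    simp only [Complex.real_smul, map_mul, Complex.conj_ofReal]
    push_cast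
    ring
  have h2 := L2.integrable_inner (𝕜 := ℂ) (oneParticleMap m f) (oneParticleMap m g)
  -- The real inner product on complex `L²` is the real part of the complex one, here already real.
  rw [← Complex.ofReal_re (freeCovariance m f g), ← h1, L2.inner_def, L2.inner_def]
  exact (integral_re h2).symm

lemma isBilinearMap_freeCovariance {m : ℝ} (hm : 0 < m) :
    IsBilinearMap ℝ (freeCovariance m) where
  add_left f g h := by simp only [freeCovariance_eq_inner hm, map_add, inner_add_left]
  smul_left c f g := by
    simp only [freeCovariance_eq_inner hm, map_smul, real_inner_smul_left, smul_eq_mul]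
  add_right f g h := by simp only [freeCovariance_eq_inner hm, map_add, inner_add_right]
  smul_right c f g := by
    simp only [freeCovariance_eq_inner hm, map_smul, real_inner_smul_right, smul_eq_mul]

lemma continuous_freeCovariance {m : ℝ} (hm : 0 < m) :
    Continuous fun p : TestFunction × TestFunction => freeCovariance m p.1 p.2 := by
  simp only [freeCovariance_eq_inner hm]
  fun_prop

lemma freeCovariance_comm {m : ℝ} (hm : 0 < m) (f g : TestFunction) :
    freeCovariance m f g = freeCovariance m g f := by
  rw [freeCovariance_eq_inner hm, freeCovariance_eq_inner hm, real_inner_comm]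

lemma freeCovariance_self {m : ℝ} (hm : 0 < m) (f : TestFunction) :
    freeCovariance m f f = ‖oneParticleMap m f‖ ^ 2 := by
  rw [freeCovariance_eq_inner hm, real_inner_self_eq_norm_sq]

end GFF

/-! ### Hilbert–Schmidt factorization and existence -/

namespace GFF

open MeasureTheory Filter Topology
open scoped FourierTransform RealInnerProductSpace SchwartzMap ComplexConjugate Laplacian

/-- The operator `1 - Δ / 4π²` on test functions. -/
noncomputable def besselOperator : TestFunction →L[ℝ] TestFunction :=
  ContinuousLinearMap.id ℝ TestFunction -
    ((2 * Real.pi) ^ 2)⁻¹ • LineDeriv.laplacianCLM ℝ Spacetime TestFunction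

lemma complexify_laplacian (f : TestFunction) : complexify (Δ f) = Δ (complexify f) := by
  ext x
  rw [SchwartzMap.laplacian_apply, complexify_apply, SchwartzMap.laplacian_apply]
  exact (ContDiffAt.laplacian_CLM_comp_left (l := Complex.ofRealCLM)
    ((f.smooth 2).contDiffAt (x := x))).symm

lemma fourier_laplacian (g : 𝓢(Spacetime, ℂ)) (w : Spacetime) :
    𝓕 (Δ g) w = -(2 * Real.pi) ^ 2 * ‖w‖ ^ 2 * 𝓕 g w := by
  rw [SchwartzMap.laplacian_eq_fourierMultiplierCLM, FourierTransform.fourier_smul,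
    SchwartzMap.fourierMultiplierCLM_apply]
  have h : (fun x : Spacetime => ‖x‖ ^ 2).HasTemperateGrowth :=
    Function.hasTemperateGrowth_norm_sq Spacetime
  have h2 := SchwartzMap.smulLeftCLM_apply_apply (F := ℂ) h (𝓕 g) w
  rw [FourierTransform.fourier_fourierInv_eq]
  change (-(2 * Real.pi) ^ 2 : ℝ) • (SchwartzMap.smulLeftCLM ℂ (fun x : Spacetime => ‖x‖ ^ 2) (𝓕 g)) w = _
  rw [h2]
  simp only [Complex.real_smul]
  push_cast
  ring

/-- The factor `1 / 4π²` in the operator normalizes its symbol to `1 + |w|²`, so that two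
applications give exactly `weight`. -/
lemma fourier_complexify_besselOperator (f : TestFunction) (w : Spacetime) :
    𝓕 (complexify (besselOperator f)) w = (1 + ‖w‖ ^ 2 : ℝ) * 𝓕 (complexify f) w := by
  have h : complexify (besselOperator f)
      = complexify f - ((2 * Real.pi) ^ 2)⁻¹ • Δ (complexify f) := by
    rw [← complexify_laplacian, ← map_smul, ← map_sub]; rfl
  have h2 : 𝓕 (complexify f - ((2 * Real.pi) ^ 2)⁻¹ • Δ (complexify f)) w
      = 𝓕 (complexify f) w - ((2 * Real.pi) ^ 2)⁻¹ • 𝓕 (Δ (complexify f)) w := by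
    rw [← FourierTransform.fourierCLM_apply (R := ℝ), map_sub, map_smul]; rfl
  rw [h, h2, fourier_laplacian, Complex.real_smul]
  have : (Real.pi : ℂ) ≠ 0 := by exact_mod_cast Real.pi_ne_zero
  push_cast
  field_simp
  ring

/-- The weight `1 + |x|²` squared. -/
noncomputable def weight (x : Spacetime) : ℝ := (1 + ‖x‖ ^ 2) ^ 2

lemma weight_pos (x : Spacetime) : 0 < weight x := by unfold weight; positivity

@[fun_prop]
lemma continuous_weight : Continuous weight := by unfold weight; fun_prop

lemma hasTemperateGrowth_weight : weight.HasTemperateGrowth := by unfold weight; fun_prop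

/-- In dimension 4 the condition is `2n > 4`. The power 4 serves the inverse weight in `L²`; the
power 3 allows an extra factor `|w|²`. -/
lemma integrable_inv_one_add_norm_sq_pow {n : ℕ} (hn : 3 ≤ n) :
    Integrable fun x : Spacetime => ((1 + ‖x‖ ^ 2) ^ n)⁻¹ := by
  have h := integrable_rpow_neg_one_add_norm_sq (E := Spacetime) (μ := volume) (r := 2 * n) (by
    have : (3 : ℝ) ≤ n := by exact_mod_cast hn
    simp; linarith)
  refine h.congr (ae_of_all _ fun x => ?_)
  have h1 : (0 : ℝ) ≤ 1 + ‖x‖ ^ 2 := by positivity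
  beta_reduce
  rw [← Real.rpow_natCast (1 + ‖x‖ ^ 2) n, ← Real.rpow_neg h1]
  congr 1
  ring

lemma memLp_inv_weight : MemLp (fun x => (weight x)⁻¹) 2 (volume : Measure Spacetime) := by
  have hc : Continuous fun x => (weight x)⁻¹ :=
    continuous_weight.inv₀ fun x => (weight_pos x).ne'
  rw [memLp_two_iff_integrable_sq hc.aestronglyMeasurable]
  refine (integrable_inv_one_add_norm_sq_pow (n := 4) (by norm_num)).congr (ae_of_all _ fun x => ?_)
  simp only [weight]
  rw [inv_pow, ← pow_mul]

/-- The weighted test function `(1 + |x|²)² (1 - Δ/4π²)² f` as an element of `L²`. -/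
noncomputable def sobolevMap : TestFunction →L[ℝ] Lp ℝ 2 (volume : Measure Spacetime) :=
  SchwartzMap.toLpCLM ℝ ℝ 2 volume ∘L SchwartzMap.smulLeftCLM ℝ weight ∘L
    besselOperator ∘L besselOperator

lemma coeFn_sobolevMap (f : TestFunction) :
    sobolevMap f =ᵐ[volume] fun x => weight x * besselOperator (besselOperator f) x := by
  refine (SchwartzMap.coeFn_toLp _ 2 volume).trans (ae_of_all _ fun x => ?_)
  exact SchwartzMap.smulLeftCLM_apply_apply hasTemperateGrowth_weight _ x

/-- The amplitude `√ρ(w) (1 + |w|²)⁻²`. -/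
noncomputable def amplitude (m : ℝ) (w : Spacetime) : ℝ := spectralRoot m w * (weight w)⁻¹

@[fun_prop]
lemma continuous_amplitude (m : ℝ) : Continuous (amplitude m) :=
  (hasTemperateGrowth_spectralRoot m).1.continuous.mul
    (continuous_weight.inv₀ fun x => (weight_pos x).ne')

lemma abs_amplitude_le {m : ℝ} (hm : 0 < m) (w : Spacetime) :
    |amplitude m w| ≤ m⁻¹ * (weight w)⁻¹ := by
  rw [amplitude, abs_mul, abs_of_pos (inv_pos.2 (weight_pos w))]
  refine mul_le_mul_of_nonneg_right ?_ (inv_pos.2 (weight_pos w)).le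
  have h : 1 ≤ 1 + ‖((2 * Real.pi / m) • w)‖ ^ 2 := by
    have := sq_nonneg ‖((2 * Real.pi / m) • w)‖
    linarith
  rw [spectralRoot, abs_of_nonneg (by positivity)]
  exact mul_le_of_le_one_right (by positivity) (Real.rpow_le_one_of_one_le_of_nonpos h (by norm_num))

lemma memLp_amplitude {m : ℝ} (hm : 0 < m) : MemLp (amplitude m) 2 volume :=
  (memLp_inv_weight.const_mul m⁻¹).mono (continuous_amplitude m).aestronglyMeasurable
    (ae_of_all _ fun w => by
      have := weight_pos w
      rw [Real.norm_eq_abs, Real.norm_of_nonneg (by positivity)]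
      exact abs_amplitude_le hm w)

lemma memLp_norm_mul_amplitude {m : ℝ} (hm : 0 < m) :
    MemLp (fun w => ‖w‖ * amplitude m w) 2 volume := by
  have hc : Continuous fun w => ‖w‖ * amplitude m w := by fun_prop
  rw [memLp_two_iff_integrable_sq hc.aestronglyMeasurable]
  have h := (integrable_inv_one_add_norm_sq_pow (n := 3) le_rfl).const_mul ((m⁻¹) ^ 2)
  refine h.mono' (by fun_prop) (ae_of_all _ fun w => ?_)
  rw [Real.norm_of_nonneg (sq_nonneg _), mul_pow, ← sq_abs (amplitude m w)]
  have h1 := pow_le_pow_left₀ (abs_nonneg _) (abs_amplitude_le hm w) 2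
  have h0 : 0 < 1 + ‖w‖ ^ 2 := by positivity
  calc ‖w‖ ^ 2 * |amplitude m w| ^ 2 ≤ (1 + ‖w‖ ^ 2) * (m⁻¹ * (weight w)⁻¹) ^ 2 :=
        mul_le_mul (by linarith) h1 (sq_nonneg _) h0.le
    _ = m⁻¹ ^ 2 * ((1 + ‖w‖ ^ 2) ^ 3)⁻¹ := by
        unfold weight; field_simp

/-- The damped plane wave `w ↦ a(w) e^{-2πi⟨x,w⟩}`. -/
noncomputable def planeWave (m : ℝ) (x w : Spacetime) : ℂ := amplitude m w • (𝐞 (-⟪x, w⟫) : ℂ)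

lemma continuous_planeWave (m : ℝ) :
    Continuous fun p : Spacetime × Spacetime => planeWave m p.1 p.2 := by
  unfold planeWave; fun_prop

lemma norm_planeWave (m : ℝ) (x w : Spacetime) : ‖planeWave m x w‖ = |amplitude m w| := by
  rw [planeWave, norm_smul, Circle.norm_coe, mul_one, Real.norm_eq_abs]

lemma memLp_planeWave {m : ℝ} (hm : 0 < m) (x : Spacetime) : MemLp (planeWave m x) 2 volume :=
  (memLp_amplitude hm).mono ((continuous_planeWave m).comp (by fun_prop : Continuous fun w => (x, w))).aestronglyMeasurable
    (ae_of_all _ fun w => (norm_planeWave m x w).le)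

/-- The damped plane wave as an element of the one-particle space. -/
noncomputable def planeWaveLp {m : ℝ} (hm : 0 < m) (x : Spacetime) :
    Lp ℂ 2 (volume : Measure Spacetime) := (memLp_planeWave hm x).toLp

lemma norm_planeWave_sub_le (m : ℝ) (x y w : Spacetime) :
    ‖planeWave m x w - planeWave m y w‖ ≤ 2 * Real.pi * ‖x - y‖ * ‖‖w‖ * amplitude m w‖ := by
  have h : planeWave m x w - planeWave m y w
      = amplitude m w • ((𝐞 (-⟪y, w⟫) : ℂ) *
        (Complex.exp (Complex.I * ((-(2 * Real.pi * ⟪x - y, w⟫) : ℝ) : ℂ)) - 1)) := by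
    rw [planeWave, planeWave, ← smul_sub, mul_sub, mul_one, Real.fourierChar_apply,
      Real.fourierChar_apply, ← Complex.exp_add, inner_sub_left]
    congr 3
    push_cast
    ring_nf
  rw [h, norm_smul, norm_mul, Circle.norm_coe, one_mul, norm_mul, norm_norm]
  have h1 : ‖Complex.exp (Complex.I * ((-(2 * Real.pi * ⟪x - y, w⟫) : ℝ) : ℂ)) - 1‖
      ≤ 2 * Real.pi * (‖x - y‖ * ‖w‖) := by
    refine Real.norm_exp_I_mul_ofReal_sub_one_le.trans ?_
    have := Real.pi_pos
    rw [norm_neg, norm_mul, Real.norm_of_nonneg (by positivity)]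
    exact mul_le_mul_of_nonneg_left (norm_inner_le_norm _ _) (by positivity)
  calc _ ≤ ‖amplitude m w‖ * (2 * Real.pi * (‖x - y‖ * ‖w‖)) :=
        mul_le_mul_of_nonneg_left h1 (norm_nonneg _)
    _ = _ := by ring

/-- The map is Lipschitz because `|w| a(w)` is square-integrable. Its continuity supplies
measurability of the vector-valued integrands. -/
lemma continuous_planeWaveLp {m : ℝ} (hm : 0 < m) : Continuous (planeWaveLp hm) := by
  have hL : ∀ x y, ‖planeWaveLp hm x - planeWaveLp hm y‖
      ≤ (2 * Real.pi * ‖(memLp_norm_mul_amplitude hm).toLp‖) * ‖x - y‖ := fun x y => by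
    rw [mul_right_comm]
    refine Lp.norm_le_mul_norm_of_ae_le_mul ?_
    filter_upwards [Lp.coeFn_sub (planeWaveLp hm x) (planeWaveLp hm y),
      (memLp_planeWave hm x).coeFn_toLp, (memLp_planeWave hm y).coeFn_toLp,
      (memLp_norm_mul_amplitude hm).coeFn_toLp] with w h1 h2 h3 h4
    rw [h1, Pi.sub_apply, planeWaveLp, planeWaveLp, h2, h3, h4]
    exact norm_planeWave_sub_le m x y w
  have hC : 0 ≤ 2 * Real.pi * ‖(memLp_norm_mul_amplitude hm).toLp‖ := by positivity
  refine (LipschitzWith.of_dist_le_mul (K := ⟨_, hC⟩) fun x y => ?_).continuous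
  rw [dist_eq_norm, dist_eq_norm]
  exact hL x y

lemma norm_planeWaveLp_le {m : ℝ} (hm : 0 < m) (x : Spacetime) :
    ‖planeWaveLp hm x‖ ≤ ‖(memLp_amplitude hm).toLp‖ := by
  refine Lp.norm_le_norm_of_ae_le ?_
  filter_upwards [(memLp_planeWave hm x).coeFn_toLp, (memLp_amplitude hm).coeFn_toLp] with w h1 h2
  rw [planeWaveLp, h1, h2, norm_planeWave, Real.norm_eq_abs]

/-- Fourier representation of the one-particle map, as a Bochner integral of plane waves. -/
lemma integral_smul_planeWaveLp {m : ℝ} (hm : 0 < m) (f : TestFunction) :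
    ∫ x, besselOperator (besselOperator f) x • planeWaveLp hm x = oneParticleMap m f := by
  set F := besselOperator (besselOperator f) with hF
  have hint : Integrable fun x => F x • planeWaveLp hm x := by
    refine F.integrable.norm.mul_const ‖(memLp_amplitude hm).toLp‖ |>.mono'
      (F.continuous.smul (continuous_planeWaveLp hm)).aestronglyMeasurable (ae_of_all _ fun x => ?_)
    rw [norm_smul]
    exact mul_le_mul_of_nonneg_left (norm_planeWaveLp_le hm x) (norm_nonneg _)
  -- Testing against `h` reduces the `L²`-valued integral to a scalar double integral, to which
  -- Fubini applies.
  refine ext_inner_left ℝ fun h => ?_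
  rw [← integral_inner hint]
  have h1 : ∀ x, ⟪h, F x • planeWaveLp hm x⟫ = ∫ w, ⟪h w, F x • planeWave m x w⟫ := fun x => by
    rw [real_inner_smul_right, L2.inner_def, ← integral_const_mul]
    refine integral_congr_ae ?_
    filter_upwards [(memLp_planeWave hm x).coeFn_toLp] with w hw
    rw [planeWaveLp, hw, real_inner_smul_right]
  simp_rw [h1]
  have hprod : Integrable (fun p : Spacetime × Spacetime => ⟪h p.2, F p.1 • planeWave m p.1 p.2⟫)
      (volume.prod volume) := by
    have hha : Integrable (fun w => ‖h w‖ * |amplitude m w|) volume :=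
      (Lp.memLp h).norm.integrable_mul (memLp_amplitude hm).abs
    refine (F.integrable.norm.mul_prod hha).mono' ?_ (ae_of_all _ fun p => ?_)
    · exact (Lp.aestronglyMeasurable h).comp_snd.inner
        ((F.continuous.comp continuous_fst).smul (continuous_planeWave m)).aestronglyMeasurable
    · refine (norm_inner_le_norm _ _).trans (le_of_eq ?_)
      rw [norm_smul, norm_planeWave]
      ring
  rw [integral_integral_swap hprod, L2.inner_def]
  refine integral_congr_ae ?_
  filter_upwards [coeFn_oneParticleMap m f] with w hw
  have hw2 : Integrable fun x => F x • planeWave m x w := by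
    refine (F.integrable.norm.mul_const |amplitude m w|).mono' ?_ (ae_of_all _ fun x => ?_)
    · exact (F.continuous.smul ((continuous_planeWave m).comp
        (by fun_prop : Continuous fun x => (x, w)))).aestronglyMeasurable
    · rw [norm_smul, norm_planeWave]
  rw [integral_inner hw2, hw]
  congr 1
  have h2 : ∫ x, F x • planeWave m x w = amplitude m w * 𝓕 (complexify F) w := by
    rw [SchwartzMap.fourier_coe, Real.fourier_eq, ← integral_const_mul]
    congr 1
    ext x
    simp only [planeWave, complexify_apply, Circle.smul_def, Complex.real_smul, smul_eq_mul]
    ring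
  -- The symbol of the squared Bessel operator cancels the inverse weight in the amplitude, leaving
  -- `√ρ f̂`.
  have hw0 : ((weight w : ℝ) : ℂ) ≠ 0 := by exact_mod_cast (weight_pos w).ne'
  rw [h2, hF, fourier_complexify_besselOperator, fourier_complexify_besselOperator, amplitude,
    ← mul_assoc (Complex.ofReal (1 + ‖w‖ ^ 2)), ← Complex.ofReal_mul, ← pow_two, ← weight,
    Complex.real_smul]
  push_cast
  field_simp

/-- The plane waves have uniformly bounded `L²` norm, so the inverse weight alone makes the kernel
square-integrable: the Hilbert–Schmidt condition. -/
lemma memLp_smul_planeWaveLp {m : ℝ} (hm : 0 < m) :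
    MemLp (fun x => (weight x)⁻¹ • planeWaveLp hm x) 2 volume := by
  have hc : Continuous fun x => (weight x)⁻¹ :=
    continuous_weight.inv₀ fun x => (weight_pos x).ne'
  refine (memLp_inv_weight.mul_const ‖(memLp_amplitude hm).toLp‖).mono
    (hc.smul (continuous_planeWaveLp hm)).aestronglyMeasurable (ae_of_all _ fun x => ?_)
  rw [norm_smul, norm_mul, norm_norm]
  exact mul_le_mul_of_nonneg_left (norm_planeWaveLp_le hm x) (norm_nonneg _)

lemma integral_sobolevMap_smul {m : ℝ} (hm : 0 < m) (f : TestFunction) :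
    ∫ x, sobolevMap f x • (weight x)⁻¹ • planeWaveLp hm x = oneParticleMap m f := by
  rw [← integral_smul_planeWaveLp hm f]
  refine integral_congr_ae ?_
  filter_upwards [coeFn_sobolevMap f] with x hx
  have := (weight_pos x).ne'
  rw [hx, smul_smul]
  congr 1
  field_simp

/-- The functional `f ↦ ⟨z, B f⟩` on test functions defined by `z ∈ L²`. -/
noncomputable def sobolevDual (z : Lp ℝ 2 (volume : Measure Spacetime)) : TemperedDual :=
  StrongDual.toWeakDual (innerSL ℝ z ∘L sobolevMap)

lemma sobolevDual_apply (z : Lp ℝ 2 (volume : Measure Spacetime)) (f : TestFunction) :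
    sobolevDual z f = ⟪z, sobolevMap f⟫ := rfl

lemma continuous_sobolevDual : Continuous sobolevDual :=
  WeakBilin.continuous_of_continuous_eval _ fun f =>
    (continuous_id.inner continuous_const : Continuous fun z => ⟪z, sobolevMap f⟫)

/-- Existence of the Gaussian free field. -/
theorem exists_gaussianFreeField {m : ℝ} (hm : 0 < m) :
    ∃ μ : Measure TemperedDual, IsProbabilityMeasure μ ∧ ∀ f : TestFunction,
      charFunctional μ f = ((Real.exp (-(1 / 2) * freeCovariance m f f) : ℝ) : ℂ) := by
  obtain ⟨ι, v, hv, hT⟩ := exists_hilbertSchmidt_coefficients (memLp_smul_planeWaveLp hm)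
  let mE : MeasurableSpace (Lp ℝ 2 (volume : Measure Spacetime)) := borel _
  have hE : BorelSpace (Lp ℝ 2 (volume : Measure Spacetime)) := ⟨rfl⟩
  obtain ⟨ν, hν, hchar⟩ := exists_gaussian_measure v hv
  have hms : Measurable sobolevDual := continuous_sobolevDual.measurable
  refine ⟨ν.map sobolevDual, Measure.isProbabilityMeasure_map hms.aemeasurable, fun f => ?_⟩
  have hexp : AEStronglyMeasurable (fun φ : TemperedDual => Complex.exp (Complex.I * (φ f : ℝ)))
      (ν.map sobolevDual) := by
    have he : Measurable fun φ : TemperedDual => φ f := (WeakDual.eval_continuous f).measurable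
    exact (Complex.measurable_exp.comp
      ((Complex.measurable_ofReal.comp he).const_mul Complex.I)).aestronglyMeasurable
  -- Reading the covariance back: `C(f, f) = ‖T f‖² = ‖A B f‖² = ∑ ⟪B f, vᵢ⟫²`, the exponent in the
  -- characteristic function of `ν` at `B f`.
  rw [charFunctional, integral_map hms.aemeasurable hexp, freeCovariance_self hm,
    ← integral_sobolevMap_smul hm f, ← hT, ← hchar]
  simp only [sobolevDual_apply, real_inner_comm]

end GFF

theorem mainTheorem2 (m : ℝ) (hm : 0 < m) :
    (∀ f g : GFF.TestFunction,
      MeasureTheory.Integrable (GFF.covarianceIntegrand m f g) MeasureTheory.volume) ∧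
    IsBilinearMap ℝ (GFF.freeCovariance m) ∧
    Continuous (fun p : GFF.TestFunction × GFF.TestFunction => GFF.freeCovariance m p.1 p.2) ∧
    (∀ f g : GFF.TestFunction, GFF.freeCovariance m f g = GFF.freeCovariance m g f) ∧
    (∀ f : GFF.TestFunction, 0 ≤ GFF.freeCovariance m f f) ∧
    ∃! μ : MeasureTheory.Measure GFF.TemperedDual,
      MeasureTheory.IsProbabilityMeasure μ ∧
      ∀ f : GFF.TestFunction,
        GFF.charFunctional μ f =
          ((Real.exp (-(1 / 2) * GFF.freeCovariance m f f) : ℝ) : ℂ) := by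
  refine ⟨GFF.integrable_covarianceIntegrand hm, GFF.isBilinearMap_freeCovariance hm,
    GFF.continuous_freeCovariance hm, GFF.freeCovariance_comm hm,
    fun f => by rw [GFF.freeCovariance_self hm]; exact sq_nonneg _, ?_⟩
  obtain ⟨μ, hμ, hchar⟩ := GFF.exists_gaussianFreeField hm
  refine ⟨μ, ⟨hμ, hchar⟩, fun ν hν => ?_⟩
  have := hν.1
  exact GFF.ext_of_charFunctional fun f => (hν.2 f).trans (hchar f).symm
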